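/- Let $P(X)=a_dX^d+\dots+a_0\in\mathbb Z[X]$ with $d\ge 1$, $a_d\ge 1$, $\gcd(a_d,\dots,a_0)=1$ and $a_0\neq 0$. Assume that $P$ has no multiple roots in $\mathbb C$ and that every irreducible factor of $P$ in $\mathbb Z[X]$ has at least one complex root of modulus greater than $1$. Let $\alpha_1,\dots,\alpha_p$ be the distinct complex roots of $P$ of modulus greater than $1$. For an integer $k\ge 0$ let $\Xi_k$ be the set of all tuples $g=(g_1,\dots,g_p)$ of polynomials in $\mathbb C[X]$ of degree at most $k$ such that $g_j=\overline{g_i}$ (conjugate coefficients) whenever $\alpha_j=\overline{\alpha_i}$; in particular, $g_i\in\mathbb R[X]$ if $\alpha_i\in\mathbb R$. For $g\in\Xi_k$ and $n\in\mathbb Z$ put $$x_n(g)=\sum_{i=1}^p g_i(n)\,\alpha_i^{\,n}\in\mathbb R .$$ For $x\in\mathbb R$ let $\|x\|$ denote the distance from $x$ to the nearest integer, and set $$\mathcal L^{(k)}(P)=\Bigl\{\limsup_{n\to\infty}\|x_n(g)\| \;:\; g\in\Xi_k\Bigr\}.$$ If $P$ is monic and hyperbolic (that is, no complex root of $P$ has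 modulus $1$), then for every integer $k\ge 0$ the set $\mathcal L^{(k)}(P)$ is a closed subset of $[0,1/2]$. -/

import Mathlib

open Polynomial Filter ComplexConjugate

namespace MarkoffSpectrum

noncomputable section

/-- The standing assumptions on an integer polynomial: it has degree at least `1`, positive leading
coefficient, coprime coefficients, nonzero constant term, no multiple complex root, and each of its
irreducible factors in `ℤ[X]` has a complex root of modulus greater than `1`. -/
structure Admissible (P : ℤ[X]) : Prop where
  one_le_natDegree : 1 ≤ P.natDegree
  one_le_leadingCoeff : 1 ≤ P.leadingCoeff
  isPrimitive : P.IsPrimitive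
  coeff_zero_ne_zero : P.coeff 0 ≠ 0
  nodup_roots : (P.aroots ℂ).Nodup
  exists_expanding_root :
    ∀ Q : ℤ[X], Irreducible Q → Q ∣ P → ∃ α ∈ Q.aroots ℂ, 1 < ‖α‖

/-- No complex root of `P` has modulus `1`. -/
def Hyperbolic (P : ℤ[X]) : Prop :=
  ∀ α ∈ P.aroots ℂ, ‖α‖ ≠ 1

/-- The complex roots of `P` of modulus greater than `1`. -/
def expandingRoots (P : ℤ[X]) : Finset ℂ :=
  (P.aroots ℂ).toFinset.filter (fun α => 1 < ‖α‖)

/-- The set `Ξ_k`: families of complex polynomials of degree at most `k`, indexed by the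
expanding roots of `P`, such that the polynomial at the complex conjugate of a root has the
conjugate coefficients (for a real root this says that the coefficients are real). -/
def Xi (P : ℤ[X]) (k : ℕ) : Set (expandingRoots P → ℂ[X]) :=
  {g | (∀ i, (g i).natDegree ≤ k) ∧
    ∀ i j : expandingRoots P, (j : ℂ) = conj (i : ℂ) → g j = (g i).map (starRingEnd ℂ)}

/-- The sequence `x_n(g) = ∑ g_α(n) α ^ n`, the sum being over the expanding roots `α` of `P`. -/
def recSeqC (P : ℤ[X]) (g : expandingRoots P → ℂ[X]) (n : ℤ) : ℂ :=
  ∑ i : expandingRoots P, (g i).eval (n : ℂ) * (i : ℂ) ^ n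

/-- The same sequence as a real number; for `g ∈ Ξ_k` the sum is real, see `ofReal_recSeq`. -/
def recSeq (P : ℤ[X]) (g : expandingRoots P → ℂ[X]) (n : ℤ) : ℝ :=
  (recSeqC P g n).re

lemma conj_mem_expandingRoots {P : ℤ[X]} {α : ℂ} (h : α ∈ expandingRoots P) :
    conj α ∈ expandingRoots P := by
  simp only [expandingRoots, Finset.mem_filter, Multiset.mem_toFinset, mem_aroots,
    RCLike.norm_conj] at h ⊢
  refine ⟨⟨h.1.1, ?_⟩, h.2⟩
  have h2 := congrArg (starRingEnd ℂ) h.1.2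
  rw [map_zero, aeval_def, hom_eval₂] at h2
  rw [aeval_def, RingHom.ext_int (algebraMap ℤ ℂ) ((starRingEnd ℂ).comp (algebraMap ℤ ℂ))]
  exact h2

lemma ofReal_recSeq {P : ℤ[X]} {k : ℕ} {g : expandingRoots P → ℂ[X]} (hg : g ∈ Xi P k) (n : ℤ) :
    ((recSeq P g n : ℝ) : ℂ) = recSeqC P g n := by
  refine Complex.conj_eq_iff_re.mp ?_
  rw [recSeqC, map_sum]
  let e : expandingRoots P → expandingRoots P := fun i => ⟨conj i.1, conj_mem_expandingRoots i.2⟩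
  have he : Function.Involutive e := fun i => Subtype.ext (Complex.conj_conj _)
  refine Fintype.sum_bijective e he.bijective _ _ fun i => ?_
  have h1 : g (e i) = (g i).map (starRingEnd ℂ) := hg.2 i (e i) rfl
  have h2 : (n : ℂ) = conj (n : ℂ) := by simp
  rw [h1, map_mul, map_zpow₀]
  congr 1
  conv_rhs => rw [h2, eval_map, eval₂_hom]

/-- The distance from a real number to the nearest integer. -/
def distInt (x : ℝ) : ℝ := |x - round x|

/-- The spectrum `L^(k)(P)` of the values `limsup ‖x_n(g)‖` as `n → ∞`, for `g ∈ Ξ_k`. -/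
def lagrangeSpectrum (P : ℤ[X]) (k : ℕ) : Set ℝ :=
  {l | ∃ g ∈ Xi P k, l = limsup (fun n : ℤ => distInt (recSeq P g n)) atTop}

end

end MarkoffSpectrum

/-!
Modulo `1`, the sequences `x_n(g)` are coded by integer words over a finite alphabet. Let `S` be the
shift on two-sided sequences and let `D` be the `(k + 1)`-st power of the monic integer polynomial
with the same roots as `P` and no multiple ones. Then `D(S)` annihilates `x(g)`, so it sends
`round x(g) - x(g)` to an integer word with bounded letters. As `P` is hyperbolic, `D(S)` is
invertible on bounded sequences, and its inverse is continuous for the product topology on words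
over a finite alphabet; so `‖x_n(g)‖` is a continuous function of the word shifted by `n`. In the
other direction, a word that vanishes far to the left is `D(S) u` for some integer sequence `u`,
because `D` is monic, and `u` minus the bounded solution is annihilated by `D(S)`; up to a term
tending to `0` its real part is some `x(g)`.

It remains to see that the upper limits of a continuous function along the orbits of a full shift
form a closed set. By compactness, orbits with upper limits tending to `l` return infinitely often
close to one common word, and gluing longer and longer pieces of them at such returns yields an
orbit with upper limit `l`.
-/

namespace MarkoffSpectrum

noncomputable section

open Topology

lemma limsup_le_of_tendsto_sub_zero {ι : Type*} {f : Filter ι} [f.NeBot] {u v : ι → ℝ}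
    (hle : IsBoundedUnder (· ≤ ·) f u) (hge : IsBoundedUnder (· ≥ ·) f u)
    (h : Tendsto (fun i => v i - u i) f (𝓝 0)) : limsup v f ≤ limsup u f := by
  have hadd := limsup_add_le hge hle h.isBoundedUnder_ge.isCoboundedUnder_le h.isBoundedUnder_le
  rw [h.limsup_eq, add_zero] at hadd
  exact (congrArg (limsup · f) (funext fun i => add_sub_cancel (u i) (v i))).ge.trans hadd

lemma limsup_eq_of_tendsto_sub_zero {ι : Type*} {f : Filter ι} [f.NeBot] {u v : ι → ℝ}
    (hle : IsBoundedUnder (· ≤ ·) f u) (hge : IsBoundedUnder (· ≥ ·) f u)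
    (h : Tendsto (fun i => v i - u i) f (𝓝 0)) : limsup v f = limsup u f := by
  have hv : v = u + fun i => v i - u i := funext fun i => (add_sub_cancel (u i) (v i)).symm
  refine le_antisymm (limsup_le_of_tendsto_sub_zero hle hge h)
    (limsup_le_of_tendsto_sub_zero ?_ ?_ (by simpa only [neg_sub, neg_zero] using h.neg))
  · exact hv ▸ isBoundedUnder_le_add hle h.isBoundedUnder_le
  · exact hv ▸ isBoundedUnder_ge_add hge h.isBoundedUnder_ge

section SymbolicDynamics

variable {A : Type*}

/-- The translate of a two-sided sequence by `n`, the `n`-th iterate of the shift. -/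
def translate (n : ℤ) (t : ℤ → A) : ℤ → A := fun m => t (n + m)

lemma translate_translate (n m : ℤ) (t : ℤ → A) :
    translate n (translate m t) = translate (m + n) t := by
  funext i
  simp only [translate, add_assoc]

/-- The set of upper limits of an observable `φ` along the forward orbits of the shift: the
Lagrange spectrum of `φ`. -/
def dynamicalSpectrum (φ : (ℤ → A) → ℝ) : Set ℝ :=
  {l | ∃ t, l = limsup (fun n : ℤ => φ (translate n t)) atTop}

lemma exists_finset_dist_lt {ι Y : Type*} [TopologicalSpace A] [CompactSpace A] [T2Space A]
    [PseudoMetricSpace Y] {φ : (ι → A) → Y} (hφ : Continuous φ) {ε : ℝ} (hε : 0 < ε) :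
    ∃ u : Finset ι, ∀ s t : ι → A, (∀ i ∈ u, s i = t i) → dist (φ s) (φ t) < ε := by
  have hK : IsCompact {p : (ι → A) × (ι → A) | ε ≤ dist (φ p.1) (φ p.2)} :=
    (isClosed_le continuous_const (by fun_prop)).isCompact
  obtain ⟨u, hu⟩ := hK.elim_finite_subfamily_closed (fun i => {p | p.1 i = p.2 i})
    (fun i => isClosed_eq (by fun_prop) (by fun_prop)) (by
      refine Set.eq_empty_iff_forall_notMem.2 fun p ⟨hp, hpi⟩ => hε.not_ge ?_
      have hp12 : p.1 = p.2 := funext fun i => Set.mem_iInter.1 hpi i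
      simpa only [Set.mem_ofPred_eq, hp12, dist_self] using hp)
  refine ⟨u, fun s t hst => lt_of_not_ge fun h => ?_⟩
  exact Set.eq_empty_iff_forall_notMem.1 hu (s, t) ⟨h, Set.mem_iInter₂.2 hst⟩

variable [TopologicalSpace A] [CompactSpace A] {φ : (ℤ → A) → ℝ}

lemma isBoundedUnder_le_translate (hφ : Continuous φ) (t : ℤ → A) :
    IsBoundedUnder (· ≤ ·) atTop fun n : ℤ => φ (translate n t) :=
  ((isCompact_range hφ).bddAbove.mono (Set.range_comp_subset_range _ φ)).isBoundedUnder_of_range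

lemma isBoundedUnder_ge_translate (hφ : Continuous φ) (t : ℤ → A) :
    IsBoundedUnder (· ≥ ·) atTop fun n : ℤ => φ (translate n t) :=
  ((isCompact_range hφ).bddBelow.mono (Set.range_comp_subset_range _ φ)).isBoundedUnder_of_range

lemma limsup_translate_congr [T2Space A] (hφ : Continuous φ) {s t : ℤ → A} (hst : s =ᶠ[atTop] t) :
    limsup (fun n : ℤ => φ (translate n s)) atTop =
      limsup (fun n : ℤ => φ (translate n t)) atTop := by
  refine limsup_eq_of_tendsto_sub_zero (isBoundedUnder_le_translate hφ t)
    (isBoundedUnder_ge_translate hφ t) (Metric.tendsto_nhds.2 fun ε hε => ?_)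
  obtain ⟨u, hu⟩ := exists_finset_dist_lt hφ hε
  have hagree : ∀ᶠ n : ℤ in atTop, ∀ m ∈ u, s (n + m) = t (n + m) :=
    u.eventually_all.2 fun m _ => (tendsto_atTop_add_const_right atTop m tendsto_id).eventually hst
  filter_upwards [hagree] with n hn
  simpa only [dist_eq_norm, sub_zero] using hu (translate n s) (translate n t) hn

lemma exists_common_clusterPt (hφ : Continuous φ) {l : ℝ} (hl : l ∈ closure (dynamicalSpectrum φ)) :
    ∃ y, l ≤ φ y ∧ ∀ U ∈ 𝓝 y, ∀ ε > 0, ∃ t : ℤ → A,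
      (∃ᶠ n : ℤ in atTop, translate n t ∈ U) ∧ ∀ᶠ n : ℤ in atTop, φ (translate n t) ≤ l + ε := by
  have happrox : ∀ N : ℕ, ∃ t y : ℤ → A, l - 1 / (N + 1) ≤ φ y ∧
      MapClusterPt y atTop (fun n : ℤ => translate n t) ∧
      ∀ᶠ n : ℤ in atTop, φ (translate n t) ≤ l + 1 / (N + 1) := by
    intro N
    obtain ⟨_, ⟨t, rfl⟩, hd⟩ := Metric.mem_closure_iff.1 hl _ (Nat.one_div_pos_of_nat (n := N))
    rw [Real.dist_eq, abs_lt] at hd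
    have hfreq : ∃ᶠ n : ℤ in atTop, translate n t ∈ {z | l - 1 / (N + 1) ≤ φ z} :=
      (frequently_lt_of_lt_limsup (isBoundedUnder_ge_translate hφ t).isCoboundedUnder_le
        (by linarith)).mono fun _ => le_of_lt
    obtain ⟨y, hy, hcluster⟩ :=
      (isClosed_le continuous_const hφ).isCompact.exists_mapClusterPt_of_frequently hfreq
    exact ⟨t, y, hy, hcluster, (eventually_lt_of_limsup_lt (b := l + 1 / (N + 1)) (by linarith)
      (isBoundedUnder_le_translate hφ t)).mono fun _ => le_of_lt⟩
  choose t z hz hcluster hev using happrox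
  obtain ⟨y, -, hy⟩ := isCompact_univ.exists_mapClusterPt_of_frequently
    (f := z) (l := atTop) (Frequently.of_forall fun _ => Set.mem_univ _)
  have hsmall : ∀ ε > (0 : ℝ), ∀ᶠ N : ℕ in atTop, 1 / ((N : ℝ) + 1) < ε := fun ε hε =>
    tendsto_one_div_add_atTop_nhds_zero_nat.eventually_lt_const hε
  refine ⟨y, le_of_forall_pos_le_add fun ε hε => ?_, fun U hU ε hε => ?_⟩
  · have hnear : ∀ᶠ x in 𝓝 y, φ x < φ y + ε / 2 :=
      hφ.continuousAt.eventually_lt_const (by linarith)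
    obtain ⟨N, hN, hN'⟩ := ((hy.frequently hnear).and_eventually (hsmall _ (half_pos hε))).exists
    linarith [hz N]
  · obtain ⟨N, hN, hN'⟩ := ((hy.frequently (eventually_mem_nhds_iff.2 hU)).and_eventually
      (hsmall ε hε)).exists
    exact ⟨t N, (hcluster N).frequently hN, (hev N).mono fun n hn => by linarith⟩

end SymbolicDynamics

section Gluing

variable {A : Type*}

lemma exists_eq_on_blocks {T : ℕ → ℤ} (hT : Monotone T) (s : ℕ → ℤ → A) :
    ∃ t : ℤ → A, ∀ N n, T N ≤ n → n < T (N + 1) → t n = s N n := by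
  have hblock : ∀ n : ℤ, ∃ M : ℕ, ∀ N, T N ≤ n → n < T (N + 1) → M = N := by
    intro n
    by_cases hn : ∃ N, T N ≤ n ∧ n < T (N + 1)
    · obtain ⟨M, hM⟩ := hn
      refine ⟨M, fun N hN hN' => by_contra fun hne => ?_⟩
      exact Set.disjoint_left.1 (hT.pairwise_disjoint_on_Ico_succ hne) hM ⟨hN, hN'⟩
    · exact ⟨0, fun N hN hN' => absurd ⟨N, hN, hN'⟩ hn⟩
  choose ν hν using hblock
  exact ⟨fun n => s (ν n) n, fun N n hN hN' => congrArg (s · n) (hν n N hN hN')⟩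

lemma exists_glued {s : ℕ → ℤ → A} {y : ℤ → A} {T : ℕ → ℤ} (hT : ∀ N, T N + N + 1 ≤ T (N + 1))
    (hleft : ∀ N : ℕ, ∀ m : ℤ, |m| ≤ N → s N (T N + m) = y m)
    (hright : ∀ N : ℕ, ∀ m : ℤ, |m| ≤ N → s N (T (N + 1) + m) = y m) :
    ∃ t : ℤ → A, ∀ N : ℕ, ∀ n m : ℤ, T N ≤ n → n < T (N + 1) → |m| < N →
      t (n + m) = s N (n + m) := by
  have hmono : Monotone T := monotone_nat_of_le_succ fun N => by linarith [hT N]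
  obtain ⟨t, ht⟩ := exists_eq_on_blocks hmono s
  have hcut : ∀ N : ℕ, ∀ m : ℤ, |m| ≤ N → t (T (N + 1) + m) = y m := by
    intro N m hm
    have hTN := hT N
    have hTN' := hT (N + 1)
    have hm' := abs_le.1 hm
    rcases lt_or_ge m 0 with hneg | hnonneg
    · rw [ht N _ (by omega) (by omega), hright N m hm]
    · rw [ht (N + 1) _ (by omega) (by omega), hleft (N + 1) m (by omega)]
  refine ⟨t, fun N n m hn hn' hm => ?_⟩
  have hm' := abs_lt.1 hm
  rcases lt_or_ge (n + m) (T N) with hbefore | hafter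
  · obtain ⟨M, rfl⟩ : ∃ M, N = M + 1 := Nat.exists_eq_succ_of_ne_zero (by rintro rfl; omega)
    have hword : |n + m - T (M + 1)| ≤ M := by rw [abs_le]; omega
    rw [← add_sub_cancel (T (M + 1)) (n + m), hcut M _ hword, hleft (M + 1) _ (by omega)]
  rcases lt_or_ge (n + m) (T (N + 1)) with hinside | hbeyond
  · exact ht N _ hafter hinside
  · have hword : |n + m - T (N + 1)| ≤ N := by rw [abs_le]; omega
    rw [← add_sub_cancel (T (N + 1)) (n + m), hcut N _ hword, hright N _ hword]

variable [TopologicalSpace A] [DiscreteTopology A]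

lemma eventually_nhds_forall_abs_le (y : ℤ → A) (N : ℕ) :
    ∀ᶠ z in 𝓝 y, ∀ m : ℤ, |m| ≤ N → z m = y m := by
  have hfin : {m : ℤ | |m| ≤ N}.Finite :=
    (Set.finite_Icc (-(N : ℤ)) N).subset fun m hm => abs_le.1 hm
  refine hfin.eventually_all.2 fun m _ => ?_
  simpa only [nhds_discrete, eventually_pure] using
    (continuous_apply m).continuousAt.eventually (f := fun z : ℤ → A => z m)
      (p := fun a => a = y m) (by simp)

lemma tendsto_atTop_of_add_le {T : ℕ → ℤ} (hT : ∀ N, T N + N + 1 ≤ T (N + 1)) :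
    Tendsto T atTop atTop := by
  have hle : ∀ N : ℕ, T 0 + N ≤ T N := fun N => by
    induction N with
    | zero => simp
    | succ N ih => have := hT N; push_cast; omega
  exact tendsto_atTop_mono hle (tendsto_atTop_add_const_left _ _ tendsto_natCast_atTop_atTop)

lemma exists_mem_block {T : ℕ → ℤ} (hT : Tendsto T atTop atTop) {N₀ : ℕ} {n : ℤ} (hn : T N₀ ≤ n) :
    ∃ N ≥ N₀, T N ≤ n ∧ n < T (N + 1) := by
  by_contra! hno
  obtain ⟨N, hN, hN'⟩ := ((eventually_ge_atTop N₀).and (hT.eventually_gt_atTop n)).exists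
  have hle : T N ≤ n := Nat.le_induction hn (fun M hM ih => hno M hM ih) N hN
  exact hle.not_gt hN'

variable [Finite A] {φ : (ℤ → A) → ℝ}

lemma exists_gluing_pieces (hφ : Continuous φ) {l : ℝ} (hl : l ∈ closure (dynamicalSpectrum φ)) :
    ∃ (y : ℤ → A) (s : ℕ → ℤ → A) (T : ℕ → ℤ), l ≤ φ y ∧
      (∀ N, T N + N + 1 ≤ T (N + 1)) ∧
      (∀ N : ℕ, ∀ m : ℤ, |m| ≤ N → s N (T N + m) = y m) ∧
      (∀ N : ℕ, ∀ m : ℤ, |m| ≤ N → s N (T (N + 1) + m) = y m) ∧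
      ∀ N, ∀ n ≥ T N, φ (translate n (s N)) ≤ l + 1 / (N + 1) := by
  obtain ⟨y, hy, horbit⟩ := exists_common_clusterPt hφ hl
  choose t hfreq hev using fun N : ℕ => horbit _ (eventually_nhds_forall_abs_le y N) _
    (Nat.one_div_pos_of_nat (n := N))
  choose c hc using fun N => eventually_atTop.1 (hev N)
  choose a ha ha' using fun N => frequently_atTop.1 (hfreq N) (c N)
  choose b hb hb' using fun N => frequently_atTop.1 (hfreq N) (a N + N + 1)
  -- The stretch of `t N` from `a N` to `b N`, two returns to `y`, becomes `[T N, T (N + 1))`.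
  let T : ℕ → ℤ := fun N => ∑ j ∈ Finset.range N, (b j - a j)
  have hT : ∀ N, T (N + 1) = T N + (b N - a N) := fun N => Finset.sum_range_succ _ _
  refine ⟨y, fun N => translate (a N - T N) (t N), T, hy, fun N => by linarith [hT N, hb N],
    fun N m hm => ?_, fun N m hm => ?_, fun N n hn => ?_⟩
  · rw [← ha' N m hm]
    exact congrArg (t N) (by ring)
  · rw [← hb' N m hm]
    exact congrArg (t N) (by rw [hT]; ring)
  · rw [translate_translate]
    exact hc N _ (by linarith [ha N])

theorem isClosed_dynamicalSpectrum (hφ : Continuous φ) : IsClosed (dynamicalSpectrum φ) := by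
  refine isClosed_of_closure_subset fun l hl => ?_
  obtain ⟨y, s, T, hy, hT, hleft, hright, hs⟩ := exists_gluing_pieces hφ hl
  obtain ⟨t, ht⟩ := exists_glued hT hleft hright
  have hTtop := tendsto_atTop_of_add_le hT
  refine ⟨t, le_antisymm ?_ ?_⟩
  · have hlim : Tendsto (fun N => translate (T N) t) atTop (𝓝 y) := by
      refine tendsto_pi_nhds.2 fun m => tendsto_nhds_of_eventually_eq ?_
      filter_upwards [tendsto_natCast_atTop_atTop.eventually_gt_atTop |m|] with N hm
      exact (ht N _ _ le_rfl (by linarith [hT N]) hm).trans (hleft N m hm.le)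
    calc l ≤ φ y := hy
      _ = limsup ((fun n => φ (translate n t)) ∘ T) atTop :=
        ((hφ.tendsto y).comp hlim).limsup_eq.symm
      _ ≤ limsup (fun n => φ (translate n t)) atTop :=
        limsup_le_limsup_of_le hTtop
          ((isBoundedUnder_ge_translate hφ t).mono hTtop).isCoboundedUnder_le
          (isBoundedUnder_le_translate hφ t)
  · refine le_of_forall_pos_le_add fun ε hε => ?_
    obtain ⟨u, hu⟩ := exists_finset_dist_lt hφ (half_pos hε)
    have hlarge : ∀ᶠ N : ℕ in atTop, 1 / ((N : ℝ) + 1) < ε / 2 ∧ ∀ m ∈ u, |m| < N :=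
      (tendsto_one_div_add_atTop_nhds_zero_nat.eventually_lt_const (half_pos hε)).and
        (u.eventually_all.2 fun m _ => tendsto_natCast_atTop_atTop.eventually_gt_atTop |m|)
    obtain ⟨N₀, hN₀⟩ := eventually_atTop.1 hlarge
    refine limsup_le_of_le (isBoundedUnder_ge_translate hφ t).isCoboundedUnder_le ?_
    filter_upwards [eventually_ge_atTop (T N₀)] with n hn
    obtain ⟨N, hN, hnN, hnN'⟩ := exists_mem_block hTtop hn
    have hclose := hu (translate n t) (translate n (s N)) fun m hm =>
      ht N n m hnN hnN' ((hN₀ N hN).2 m hm)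
    linarith [(abs_lt.1 hclose).2, hs N n hnN, (hN₀ N hN).1]

end Gluing

open scoped BoundedContinuousFunction

/-- The shift `f ↦ (n ↦ f (n + 1))` on two-sided sequences. -/
def shift (R : Type*) [CommRing R] : Module.End R (ℤ → R) := LinearMap.funLeft R R (· + 1)

lemma map_aeval_apply {R S M N : Type*} [CommSemiring R] [CommSemiring S] [AddCommMonoid M]
    [AddCommMonoid N] [Module R M] [Module S N] {σ : R →+* S} (L : M →ₛₗ[σ] N)
    {u : Module.End R M} {v : Module.End S N} (h : ∀ x, L (u x) = v (L x)) (p : R[X]) (x : M) :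
    L (aeval u p x) = aeval v (p.map σ) (L x) := by
  induction p using Polynomial.induction_on generalizing x with
  | C a => simp [Module.algebraMap_end_apply]
  | add p q hp hq => simp [hp, hq]
  | monomial n a ih =>
    simpa [pow_succ, ← mul_assoc, h] using ih (u x)

lemma isUnit_aeval_of_norm_le_one {𝔸 : Type*} [NormedRing 𝔸] [NormedAlgebra ℂ 𝔸] [CompleteSpace 𝔸]
    [NormOneClass 𝔸] {u : 𝔸ˣ} (hu : ‖(u : 𝔸)‖ ≤ 1) (hu' : ‖(↑u⁻¹ : 𝔸)‖ ≤ 1) {Q : ℂ[X]}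
    (hQ : ∀ z, Q.IsRoot z → ‖z‖ ≠ 1) : IsUnit (aeval (u : 𝔸) Q) := by
  have : Nontrivial 𝔸 := NormOneClass.nontrivial
  refine (spectrum.zero_notMem_iff ℂ).1 fun h => ?_
  rw [spectrum.map_polynomial_aeval] at h
  obtain ⟨z, hz, hroot⟩ := h
  have hz0 : z ≠ 0 := spectrum.ne_zero_of_mem_of_unit hz
  have hinv : z⁻¹ ∈ spectrum ℂ (↑u⁻¹ : 𝔸) := (spectrum.inv_mem_iff (r := Units.mk0 z hz0)).1 hz
  refine hQ z hroot (le_antisymm ((spectrum.norm_le_norm_of_mem hz).trans hu) ?_)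
  have hle : ‖z⁻¹‖ ≤ 1 := (spectrum.norm_le_norm_of_mem hinv).trans hu'
  rw [norm_inv] at hle
  exact (inv_le_one₀ (norm_pos_iff.2 hz0)).1 hle

/-- The shift by `n` on bounded sequences. -/
def boundedShift (n : ℤ) : (ℤ →ᵇ ℂ) →L[ℂ] (ℤ →ᵇ ℂ) :=
  BoundedContinuousFunction.compContinuousCLM ℂ ℂ ⟨(· + n), continuous_of_discreteTopology⟩

lemma norm_boundedShift_le (n : ℤ) : ‖boundedShift n‖ ≤ 1 :=
  ContinuousLinearMap.opNorm_le_bound _ zero_le_one fun f => by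
    exact (f.norm_compContinuous_le _).trans_eq (one_mul _).symm

lemma isUnit_aeval_boundedShift {Q : ℂ[X]} (hQ : ∀ z, Q.IsRoot z → ‖z‖ ≠ 1) :
    IsUnit (aeval (boundedShift 1) Q) := by
  have hinv : ∀ n, boundedShift n * boundedShift (-n) = 1 := fun n => by
    ext f m
    simp [boundedShift]
  have : Nontrivial (ℤ →ᵇ ℂ) := ⟨0, 1, fun h => zero_ne_one (DFunLike.congr_fun h 0)⟩
  exact isUnit_aeval_of_norm_le_one
    (u := ⟨boundedShift 1, boundedShift (-1), hinv 1, by simpa using hinv (-1)⟩)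
    (norm_boundedShift_le _) (norm_boundedShift_le _) hQ

lemma coe_aeval_boundedShift (Q : ℂ[X]) (f : ℤ →ᵇ ℂ) :
    ⇑(aeval (boundedShift 1) Q f) = aeval (shift ℂ) Q f := by
  let L : (ℤ →ᵇ ℂ) →ₗ[ℂ] (ℤ → ℂ) := ⟨⟨(⇑), BoundedContinuousFunction.coe_add⟩, fun _ _ => rfl⟩
  let coeLM : ((ℤ →ᵇ ℂ) →L[ℂ] (ℤ →ᵇ ℂ)) →ₐ[ℂ] Module.End ℂ (ℤ →ᵇ ℂ) :=
    { ContinuousLinearMap.toLinearMapRingHom with commutes' := fun _ => rfl }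
  have h := map_aeval_apply L (u := coeLM (boundedShift 1)) (v := shift ℂ) (fun _ => rfl) Q f
  rw [aeval_algHom_apply, Polynomial.map_id] at h
  exact h

lemma continuous_of_isClosed_graph {X K : Type*} [TopologicalSpace X] [TopologicalSpace K]
    [CompactSpace K] {f : X → K} (hf : IsClosed {p : X × K | f p.1 = p.2}) : Continuous f := by
  refine continuous_iff_isClosed.2 fun F hF => ?_
  convert isClosedMap_fst_of_compactSpace _ (hf.inter (hF.preimage continuous_snd)) using 1
  ext x
  simp

lemma aeval_shift_apply {R : Type*} [CommRing R] (D : R[X]) (f : ℤ → R) (n : ℤ) :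
    aeval (shift R) D f n = ∑ i ∈ Finset.range (D.natDegree + 1), D.coeff i * f (n + i) := by
  have hpow : ∀ (i : ℕ) (m : ℤ), (shift R ^ i) f m = f (m + i) := by
    intro i
    induction i with
    | zero => simp
    | succ i ih =>
      intro m
      rw [pow_succ', Module.End.mul_apply]
      exact (ih (m + 1)).trans (congrArg f (by push_cast; ring))
  simp [aeval_eq_sum_range, hpow]

lemma aeval_shift_comp_add {R : Type*} [CommRing R] (D : R[X]) (f : ℤ → R) (n m : ℤ) :
    aeval (shift R) D (fun i => f (n + i)) m = aeval (shift R) D f (n + m) := by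
  simp only [aeval_shift_apply, add_assoc]

lemma continuous_aeval_shift (Q : ℂ[X]) : Continuous (aeval (shift ℂ) Q) := by
  refine continuous_pi fun n => ?_
  simp only [aeval_shift_apply]
  fun_prop

lemma eq_of_aeval_shift_eq {Q : ℂ[X]} (hQ : ∀ z, Q.IsRoot z → ‖z‖ ≠ 1) {f g : ℤ → ℂ} {B : ℝ}
    (hf : ∀ n, ‖f n‖ ≤ B) (hg : ∀ n, ‖g n‖ ≤ B)
    (hfg : aeval (shift ℂ) Q f = aeval (shift ℂ) Q g) : f = g := by
  obtain ⟨V, hV⟩ := (isUnit_aeval_boundedShift hQ).exists_left_inv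
  let F : ℤ →ᵇ ℂ := .ofNormedAddCommGroupDiscrete f B hf
  let G : ℤ →ᵇ ℂ := .ofNormedAddCommGroupDiscrete g B hg
  have hFG : aeval (boundedShift 1) Q F = aeval (boundedShift 1) Q G :=
    DFunLike.coe_injective <|
      (coe_aeval_boundedShift Q F).trans (hfg.trans (coe_aeval_boundedShift Q G).symm)
  have hV' : ∀ H, V (aeval (boundedShift 1) Q H) = H := DFunLike.congr_fun hV
  have : F = G := by rw [← hV' F, hFG, hV']
  exact congrArg (⇑) this

lemma exists_bounded_aeval_shift_eq {Q : ℂ[X]} (hQ : ∀ z, Q.IsRoot z → ‖z‖ ≠ 1) (B : ℝ) :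
    ∃ C, ∀ w : ℤ → ℂ, (∀ n, ‖w n‖ ≤ B) →
      ∃ y : ℤ → ℂ, (∀ n, ‖y n‖ ≤ C) ∧ aeval (shift ℂ) Q y = w := by
  obtain ⟨V, hV⟩ := (isUnit_aeval_boundedShift hQ).exists_right_inv
  refine ⟨‖V‖ * B, fun w hw => ?_⟩
  let W : ℤ →ᵇ ℂ := .ofNormedAddCommGroupDiscrete w B hw
  have hW : ‖W‖ ≤ B := BoundedContinuousFunction.norm_le_of_nonempty.2 hw
  refine ⟨V W, fun n => ((V W).norm_coe_le_norm n).trans (V.le_of_opNorm_le_of_le le_rfl hW), ?_⟩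
  rw [← coe_aeval_boundedShift]
  exact congrArg (⇑) (DFunLike.congr_fun hV W)

lemma exists_continuous_bounded_solution {X : Type*} [TopologicalSpace X] {Q : ℂ[X]}
    (hQ : ∀ z, Q.IsRoot z → ‖z‖ ≠ 1) {w : X → ℤ → ℂ} (hw : Continuous w) {B : ℝ}
    (hB : ∀ x n, ‖w x n‖ ≤ B) :
    ∃ y : X → ℤ → ℂ, Continuous y ∧ (∃ C, ∀ x n, ‖y x n‖ ≤ C) ∧
      ∀ x, aeval (shift ℂ) Q (y x) = w x := by
  obtain ⟨C, hC⟩ := exists_bounded_aeval_shift_eq hQ B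
  choose y hyC hy using fun x => hC (w x) (hB x)
  let z : X → ℤ → Metric.closedBall (0 : ℂ) C :=
    fun x n => ⟨y x n, mem_closedBall_zero_iff.2 (hyC x n)⟩
  -- By uniqueness of bounded solutions, the graph is cut out by the equation, hence closed.
  have hgraph : {p : X × (ℤ → Metric.closedBall (0 : ℂ) C) | z p.1 = p.2} =
      {p | aeval (shift ℂ) Q (fun n => (p.2 n : ℂ)) = w p.1} := by
    ext ⟨x, v⟩
    refine ⟨fun h => ?_, fun h => ?_⟩
    · obtain rfl : z x = v := h
      exact hy x
    · have := eq_of_aeval_shift_eq hQ (hyC x) (fun n => mem_closedBall_zero_iff.1 (v n).2)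
        ((hy x).trans (Eq.symm h))
      exact funext fun n => Subtype.ext (congrFun this n)
  have hz : Continuous z := continuous_of_isClosed_graph <| hgraph ▸
    isClosed_eq ((continuous_aeval_shift Q).comp (by fun_prop)) (by fun_prop)
  exact ⟨y, continuous_pi fun n => continuous_subtype_val.comp ((continuous_apply n).comp hz),
    ⟨C, hyC⟩, hy⟩

section LaurentSeries

variable {R : Type*} [CommRing R]

lemma coeff_eval₂_single_neg_one_mul (D : R[X]) (L : LaurentSeries R) :
    (D.eval₂ HahnSeries.C (HahnSeries.single (-1) 1) * L).coeff = aeval (shift R) D L.coeff := by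
  have hshift (M : LaurentSeries R) :
      (HahnSeries.single (-1) 1 * M).coeff = shift R M.coeff := by
    funext n
    have h := HahnSeries.coeff_single_mul_add (r := (1 : R)) (x := M) (a := n + 1) (b := -1)
    rwa [add_neg_cancel_right, one_mul] at h
  induction D using Polynomial.induction_on generalizing L with
  | C a =>
    rw [eval₂_C, aeval_C, HahnSeries.C_mul_eq_smul, HahnSeries.coeff_smul',
      Module.algebraMap_end_apply]
  | add p q hp hq => rw [eval₂_add, add_mul, HahnSeries.coeff_add', hp, hq, map_add,
      LinearMap.add_apply]
  | monomial n a ih =>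
    rw [pow_succ, ← mul_assoc, eval₂_mul, map_mul, eval₂_X, aeval_X, mul_assoc, ih, hshift,
      Module.End.mul_apply]

lemma isUnit_eval₂_single_neg_one {D : R[X]} (hD : D.Monic) :
    IsUnit (D.eval₂ HahnSeries.C (HahnSeries.single (-1) 1 : LaurentSeries R)) := by
  have hX : (HahnSeries.single (-1) 1 : LaurentSeries R) * HahnSeries.single 1 1 = 1 := by simp
  have := invertibleOfRightInverse _ _ hX
  have hrev : IsUnit (D.reverse : PowerSeries R) := by
    rw [PowerSeries.isUnit_iff_constantCoeff]
    simp [hD.leadingCoeff]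
  have hmap := hrev.map (HahnSeries.ofPowerSeries ℤ R)
  have hC : (HahnSeries.ofPowerSeries ℤ R).comp PowerSeries.C = HahnSeries.C :=
    RingHom.ext HahnSeries.ofPowerSeries_C
  rw [← eval₂_C_X_eq_coe, hom_eval₂, HahnSeries.ofPowerSeries_X, hC, ← invOf_eq_right_inv hX]
    at hmap
  -- `D(1/X) = X⁻ᵈ * D.reverse`, and `D.reverse` has constant term `1`.
  rw [← eval₂_reverse_mul_pow]
  exact hmap.mul ((isUnit_of_invertible _).pow _)

lemma exists_aeval_shift_eq {D : R[X]} (hD : D.Monic) {t : ℤ → R}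
    (ht : BddBelow (Function.support t)) : ∃ u : ℤ → R, aeval (shift R) D u = t := by
  obtain ⟨V, hV⟩ := (isUnit_eval₂_single_neg_one hD).exists_right_inv
  refine ⟨(V * HahnSeries.ofSuppBddBelow t ht).coeff, ?_⟩
  rw [← coeff_eval₂_single_neg_one_mul, ← mul_assoc, hV, one_mul, HahnSeries.coeff_ofSuppBddBelow]

end LaurentSeries

section Kernel

variable {K : Type*} [Field K]

open fwdDiff in
lemma aeval_shift_X_sub_C_pow_apply {β : K} (hβ : β ≠ 0) (m : ℕ) (z : ℤ → K) (n : ℤ) :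
    aeval (shift K) ((X - C β) ^ m) z n =
      β ^ (n + m) * (Δ_[(1 : ℤ)])^[m] (fun j => β ^ (-j) * z j) n := by
  induction m generalizing n with
  | zero => simp [zpow_neg, mul_inv_cancel_left₀ (zpow_ne_zero n hβ)]
  | succ m ih =>
    have hX (f : ℤ → K) : aeval (shift K) (X - C β) f n = f (n + 1) - β * f n := by
      simp [shift, Module.algebraMap_end_apply]
    rw [pow_succ', map_mul, Module.End.mul_apply, hX, ih, ih, Function.iterate_succ_apply',
      fwdDiff, show n + 1 + (m : ℤ) = n + m + 1 by ring,
      show n + ((m + 1 : ℕ) : ℤ) = n + m + 1 by push_cast; ring, zpow_add_one₀ hβ]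
    ring

lemma fwdDiff_iter_eq_zero_of_le {G : Type*} [AddCommGroup G] {w : ℤ → G} {i j : ℕ} (hij : i ≤ j)
    (hw : (fwdDiff (1 : ℤ))^[i] w = 0) : (fwdDiff (1 : ℤ))^[j] w = 0 := by
  obtain ⟨m, rfl⟩ := Nat.exists_eq_add_of_le' hij
  rw [Function.iterate_add_apply, hw]
  exact Function.iterate_fixed (fwdDiff_const (1 : ℤ) (0 : G)) m

lemma exists_polynomial_of_fwdDiff_iter_eq_zero [CharZero K] {w : ℤ → K} {k : ℕ}
    (hw : (fwdDiff (1 : ℤ))^[k + 1] w = 0) :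
    ∃ g : K[X], g.natDegree ≤ k ∧ ∀ n : ℕ, w n = g.eval (n : K) := by
  refine ⟨∑ j ∈ Finset.range (k + 1),
    C ((fwdDiff (1 : ℤ))^[j] w 0 / (j.factorial : K)) * descPochhammer K j, ?_, fun n => ?_⟩
  · refine natDegree_sum_le_of_forall_le _ _ fun j hj => (natDegree_C_mul_le _ _).trans ?_
    rw [descPochhammer_natDegree]
    exact Finset.mem_range_succ_iff.1 hj
  · have hterm (j : ℕ) : (C ((fwdDiff (1 : ℤ))^[j] w 0 / (j.factorial : K)) *
        descPochhammer K j).eval (n : K) = n.choose j • (fwdDiff (1 : ℤ))^[j] w 0 := by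
      have : (j.factorial : K) ≠ 0 := by exact_mod_cast j.factorial_ne_zero
      rw [eval_mul, eval_C, descPochhammer_eval_eq_descFactorial,
        Nat.descFactorial_eq_factorial_mul_choose, nsmul_eq_mul]
      push_cast
      field_simp
    have hnewton := shift_eq_sum_fwdDiff_iter (1 : ℤ) w n 0
    rw [zero_add, nsmul_one] at hnewton
    rw [hnewton, eval_finsetSum, Finset.sum_congr rfl fun j _ => hterm j]
    refine Finset.sum_congr_of_eq_on_inter (fun j _ hj => ?_) (fun j _ hj => ?_) fun _ _ _ => rfl
    · rw [fwdDiff_iter_eq_zero_of_le (by simpa using hj) hw, Pi.zero_apply, smul_zero]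
    · rw [Nat.choose_eq_zero_of_lt (by simpa using hj), zero_smul]

lemma exists_eval_mul_pow_of_mem_ker [CharZero K] {β : K} {k : ℕ} {z : ℤ → K}
    (hz : aeval (shift K) ((X - C β) ^ (k + 1)) z = 0) :
    ∃ g : K[X], g.natDegree ≤ k ∧ ∀ n : ℕ, z n = g.eval (n : K) * β ^ n := by
  rcases eq_or_ne β 0 with rfl | hβ
  · have hz0 : z = 0 := by
      funext n
      have h := congrFun hz (n - (k + 1 : ℕ))
      rw [C_0, sub_zero, aeval_shift_apply] at h
      simpa [coeff_X_pow] using h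
    exact ⟨0, by simp, by simp [hz0]⟩
  obtain ⟨g, hg, h⟩ := exists_polynomial_of_fwdDiff_iter_eq_zero (k := k)
    (w := fun j => β ^ (-j) * z j) <| funext fun n => by
      have := congrFun hz n
      rw [aeval_shift_X_sub_C_pow_apply hβ, Pi.zero_apply, mul_eq_zero] at this
      exact this.resolve_left (zpow_ne_zero _ hβ)
  refine ⟨g, hg, fun n => ?_⟩
  rw [← h n, zpow_neg, zpow_natCast, mul_right_comm, inv_mul_cancel₀ (pow_ne_zero n hβ), one_mul]

lemma exists_sum_eval_mul_pow_of_mem_ker [CharZero K] (S : Finset K) {k : ℕ} {z : ℤ → K}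
    (hz : aeval (shift K) (∏ β ∈ S, (X - C β) ^ (k + 1)) z = 0) :
    ∃ g : K → K[X], (∀ β, (g β).natDegree ≤ k) ∧
      ∀ n : ℕ, z n = ∑ β ∈ S, (g β).eval (n : K) * β ^ n := by
  classical
  induction S using Finset.induction_on generalizing z with
  | empty => exact ⟨0, by simp, fun n => by simpa using congrFun hz n⟩
  | insert γ S hγ ih =>
    rw [Finset.prod_insert hγ] at hz
    have hcop : IsCoprime ((X - C γ) ^ (k + 1)) (∏ β ∈ S, (X - C β) ^ (k + 1)) :=
      IsCoprime.prod_right fun β hβ => IsCoprime.pow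
        (pairwise_coprime_X_sub_C Function.injective_id (ne_of_mem_of_not_mem hβ hγ).symm)
    have hmem := LinearMap.mem_ker.2 hz
    rw [← sup_ker_aeval_eq_ker_aeval_mul_of_coprime _ hcop, Submodule.mem_sup] at hmem
    obtain ⟨y, hy, y', hy', rfl⟩ := hmem
    obtain ⟨p, hp, hyp⟩ := exists_eval_mul_pow_of_mem_ker hy
    obtain ⟨g, hg, hyg⟩ := ih hy'
    refine ⟨Function.update g γ p, fun β => ?_, fun n => ?_⟩
    · rcases eq_or_ne β γ with rfl | h
      · rwa [Function.update_self]
      · rw [Function.update_of_ne h]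
        exact hg β
    · rw [Finset.sum_insert hγ, Function.update_self, Pi.add_apply, hyp, hyg]
      congr 1
      refine Finset.sum_congr rfl fun β hβ => ?_
      rw [Function.update_of_ne (ne_of_mem_of_not_mem hβ hγ)]

lemma aeval_shift_X_sub_C_pow_eval_mul_zpow {β : K} (hβ : β ≠ 0) {k : ℕ} {g : K[X]}
    (hg : g.natDegree ≤ k) :
    aeval (shift K) ((X - C β) ^ (k + 1)) (fun n : ℤ => g.eval (n : K) * β ^ n) = 0 := by
  funext n
  have hcancel : (fun j : ℤ => β ^ (-j) * (g.eval (j : K) * β ^ j)) = fun j : ℤ => g.eval (j : K) :=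
    funext fun j => by
      rw [mul_left_comm, zpow_neg, inv_mul_cancel₀ (zpow_ne_zero j hβ), mul_one]
  have hdiff := congrFun (fwdDiff_iter_eq_zero_of_degree_lt (Nat.lt_succ_iff.2 hg)) (n : K)
  rw [fwdDiff_iter_eq_sum_shift] at hdiff
  rw [aeval_shift_X_sub_C_pow_apply hβ, hcancel, fwdDiff_iter_eq_sum_shift]
  simpa using Or.inr hdiff

end Kernel

lemma tendsto_eval_mul_pow_of_norm_lt_one {K : Type*} [NormedField K] {β : K}
    (hβ : ‖β‖ < 1) (g : K[X]) :
    Tendsto (fun n : ℕ => g.eval (n : K) * β ^ n) atTop (𝓝 0) := by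
  simp only [eval_eq_sum_range, Finset.sum_mul, mul_assoc]
  rw [← Finset.sum_const_zero (s := Finset.range (g.natDegree + 1))]
  refine tendsto_finsetSum _ fun j _ => ?_
  simpa using (summable_pow_mul_geometric_of_norm_lt_one j hβ).tendsto_atTop_zero.const_mul
    (g.coeff j)

section Radical

variable (K : Type*) {R L : Type*} [CommRing R] [IsIntegrallyClosed R] [Field K]
  [PerfectField K] [Algebra R K] [IsFractionRing R K]

lemma exists_monic_separable_dvd_dvd_pow {P : R[X]} (hP : P.Monic) :
    ∃ Q : R[X], Q.Monic ∧ (Q.map (algebraMap R K)).Separable ∧ Q ∣ P ∧ ∃ m, P ∣ Q ^ m := by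
  classical
  have hinj := IsFractionRing.injective R K
  generalize hr : UniqueFactorizationMonoid.radical (P.map (algebraMap R K)) = r
  have hr0 : r.leadingCoeff ≠ 0 :=
    leadingCoeff_ne_zero.2 (hr ▸ UniqueFactorizationMonoid.radical_ne_zero)
  have hrP : r ∣ P.map (algebraMap R K) := hr ▸ UniqueFactorizationMonoid.radical_dvd_self
  have hsep : r.Separable :=
    PerfectField.separable_iff_squarefree.2 (hr ▸ UniqueFactorizationMonoid.squarefree_radical)
  obtain ⟨m, hPr⟩ := UniqueFactorizationMonoid.exists_dvd_radical_self_pow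
    (hP.map (algebraMap R K)).ne_zero
  rw [hr] at hPr
  obtain ⟨Q, hQ⟩ := IsIntegrallyClosed.eq_map_mul_C_of_dvd K hP hrP
  have hassoc : Associated r (Q.map (algebraMap R K)) :=
    .symm ⟨(isUnit_C.2 hr0.isUnit).unit, hQ⟩
  have hQm : Q.Monic := by
    refine monic_of_injective hinj (mul_right_cancel₀ hr0 ?_)
    have h := congrArg leadingCoeff hQ
    rw [leadingCoeff_mul, leadingCoeff_C] at h
    exact h.trans (one_mul _).symm
  refine ⟨Q, hQm, hsep.of_dvd hassoc.symm.dvd, (map_dvd_map _ hinj hQm).1 ?_, m,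
    (map_dvd_map _ hinj hP).1 ?_⟩
  · exact hassoc.symm.dvd.trans hrP
  · rw [Polynomial.map_pow]
    exact hPr.trans (pow_dvd_pow_of_dvd hassoc.dvd m)

lemma exists_monic_map_eq_prod_aroots_toFinset [Field L] [IsAlgClosed L] [DecidableEq L]
    [Algebra R L] [Algebra K L] [IsScalarTower R K L] {P : R[X]} (hP : P.Monic) :
    ∃ Q : R[X], Q.Monic ∧ Q.map (algebraMap R L) = ∏ β ∈ (P.aroots L).toFinset, (X - C β) := by
  obtain ⟨Q, hQ, hsep, hQP, m, hPQ⟩ := exists_monic_separable_dvd_dvd_pow K hP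
  have hnodup : (Q.aroots L).Nodup := by
    rw [aroots_def, IsScalarTower.algebraMap_eq R K L, ← Polynomial.map_map]
    exact nodup_roots hsep.map
  have hroots : (Q.aroots L).toFinset = (P.aroots L).toFinset := by
    ext β
    simp only [Multiset.mem_toFinset, mem_aroots', (hQ.map _).ne_zero, (hP.map _).ne_zero, ne_eq,
      not_false_eq_true, true_and]
    refine ⟨aeval_eq_zero_of_dvd_aeval_eq_zero hQP, fun h => ?_⟩
    have hpow := aeval_eq_zero_of_dvd_aeval_eq_zero hPQ h
    rw [map_pow] at hpow
    exact eq_zero_of_pow_eq_zero hpow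
  refine ⟨Q, hQ, ?_⟩
  rw [(IsAlgClosed.splits _).eq_prod_roots_of_monic (hQ.map _), ← hroots, Finset.prod,
    Multiset.toFinset_val, hnodup.dedup]

end Radical

section DistInt

lemma distInt_eq_norm (x : ℝ) : distInt x = ‖(x : UnitAddCircle)‖ := UnitAddCircle.norm_eq.symm

lemma continuous_distInt : Continuous distInt := by
  rw [funext distInt_eq_norm]
  exact continuous_norm.comp (AddCircle.continuous_mk' 1)

lemma abs_distInt_sub_distInt_le (x y : ℝ) : |distInt x - distInt y| ≤ |x - y| := by
  rw [distInt_eq_norm, distInt_eq_norm]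
  refine (abs_norm_sub_norm_le _ _).trans ?_
  rw [← QuotientAddGroup.mk_sub]
  exact QuotientAddGroup.norm_mk_le_norm

lemma distInt_intCast_sub (m : ℤ) (x : ℝ) : distInt (m - x) = distInt x := by
  have hm : ((m : ℝ) : UnitAddCircle) = 0 := (AddCircle.coe_eq_zero_iff 1).2 ⟨m, by simp⟩
  rw [distInt_eq_norm, distInt_eq_norm, AddCircle.coe_sub, hm, zero_sub, norm_neg]

lemma lagrangeSpectrum_subset_Icc (P : ℤ[X]) (k : ℕ) :
    lagrangeSpectrum P k ⊆ Set.Icc 0 (1 / 2) := by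
  rintro l ⟨g, -, rfl⟩
  have hnonneg (x : ℝ) : 0 ≤ distInt x := abs_nonneg _
  have hle (x : ℝ) : distInt x ≤ 1 / 2 := abs_sub_round x
  exact ⟨le_limsup_of_frequently_le (.of_forall fun _ => hnonneg _)
      (isBoundedUnder_of ⟨1 / 2, fun _ => hle _⟩),
    limsup_le_of_le (isBoundedUnder_of ⟨0, fun _ => hnonneg _⟩ :
      IsBoundedUnder (· ≥ ·) _ _).isCoboundedUnder_le (.of_forall fun _ => hle _)⟩

end DistInt

section Recurrence

variable {P : ℤ[X]} {k : ℕ}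

lemma aeval_shift_recSeqC {g : expandingRoots P → ℂ[X]} (hg : ∀ i, (g i).natDegree ≤ k) :
    aeval (shift ℂ) (∏ β ∈ (P.aroots ℂ).toFinset, (X - C β) ^ (k + 1)) (recSeqC P g) = 0 := by
  have hsum : recSeqC P g = ∑ i, fun n : ℤ => (g i).eval (n : ℂ) * (i : ℂ) ^ n := by
    funext n
    rw [recSeqC, Finset.sum_apply]
  rw [hsum, map_sum]
  refine Finset.sum_eq_zero fun i _ => ?_
  obtain ⟨hroot, hi⟩ := Finset.mem_filter.1 i.2
  have hi0 : (i : ℂ) ≠ 0 := norm_pos_iff.1 (zero_lt_one.trans hi)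
  rw [← Finset.prod_erase_mul _ _ hroot, map_mul, Module.End.mul_apply,
    aeval_shift_X_sub_C_pow_eval_mul_zpow hi0 (hg i), map_zero]

lemma exists_mem_Xi_recSeq_eq {G : expandingRoots P → ℂ[X]} (hG : ∀ i, (G i).natDegree ≤ k) :
    ∃ g ∈ Xi P k, ∀ n, recSeq P g n = (recSeqC P G n).re := by
  let e : expandingRoots P → expandingRoots P := fun i => ⟨conj i.1, conj_mem_expandingRoots i.2⟩
  have he : Function.Involutive e := fun i => Subtype.ext (Complex.conj_conj _)
  let g : expandingRoots P → ℂ[X] := fun i => C (1 / 2) * (G i + (G (e i)).map (starRingEnd ℂ))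
  have hconj (n : ℤ) :
      ∑ i : expandingRoots P, ((G (e i)).map (starRingEnd ℂ)).eval (n : ℂ) * (i : ℂ) ^ n =
        conj (recSeqC P G n) := by
    rw [recSeqC, map_sum]
    refine Fintype.sum_bijective e he.bijective _ _ fun i => ?_
    rw [map_mul, map_zpow₀, ← map_intCast (starRingEnd ℂ) n, eval_map, eval₂_hom, map_intCast]
    simp [e]
  have hg (n : ℤ) : recSeqC P g n = 1 / 2 * (recSeqC P G n + conj (recSeqC P G n)) := by
    rw [← hconj, recSeqC, recSeqC, ← Finset.sum_add_distrib, Finset.mul_sum]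
    refine Finset.sum_congr rfl fun i _ => ?_
    rw [eval_mul, eval_C, eval_add]
    ring
  refine ⟨g, ⟨fun i => ?_, fun i j hij => ?_⟩, fun n => ?_⟩
  · exact (natDegree_C_mul_le _ _).trans
      (natDegree_add_le_of_degree_le (hG i) (natDegree_map_le.trans (hG _)))
  · obtain rfl : j = e i := Subtype.ext hij
    simp [g, he i, Polynomial.map_map, add_comm, Complex.conj_ofNat]
  · rw [recSeq, hg, Complex.add_conj]
    simp

lemma exists_mem_Xi_tendsto_sub (hhyp : Hyperbolic P) {z : ℤ → ℂ}
    (hz : aeval (shift ℂ) (∏ β ∈ (P.aroots ℂ).toFinset, (X - C β) ^ (k + 1)) z = 0) :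
    ∃ g ∈ Xi P k, Tendsto (fun n : ℤ => recSeq P g n - (z n).re) atTop (𝓝 0) := by
  obtain ⟨G, hG, hzG⟩ := exists_sum_eval_mul_pow_of_mem_ker _ hz
  obtain ⟨g, hg, hgG⟩ := exists_mem_Xi_recSeq_eq (P := P) (G := fun i => G i) fun i => hG i
  refine ⟨g, hg, ?_⟩
  have hcontracting : Tendsto (fun n : ℕ => ∑ β ∈ (P.aroots ℂ).toFinset with ¬ 1 < ‖β‖,
      (G β).eval (n : ℂ) * β ^ n) atTop (𝓝 0) := by
    rw [← Finset.sum_const_zero (s := (P.aroots ℂ).toFinset.filter fun β => ¬ 1 < ‖β‖)]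
    refine tendsto_finsetSum _ fun β hβ => tendsto_eval_mul_pow_of_norm_lt_one ?_ _
    obtain ⟨hroot, hle⟩ := Finset.mem_filter.1 hβ
    exact (not_lt.1 hle).lt_of_ne (hhyp β (Multiset.mem_toFinset.1 hroot))
  have hsub (n : ℕ) : recSeq P g n - (z n).re = -(∑ β ∈ (P.aroots ℂ).toFinset with ¬ 1 < ‖β‖,
      (G β).eval (n : ℂ) * β ^ n).re := by
    have hsplit := Finset.sum_filter_add_sum_filter_not (P.aroots ℂ).toFinset (fun β => 1 < ‖β‖)
      fun β => (G β).eval (n : ℂ) * β ^ n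
    have hexp : recSeqC P (fun i => G i) n =
        ∑ β ∈ (P.aroots ℂ).toFinset with 1 < ‖β‖, (G β).eval (n : ℂ) * β ^ n := by
      simp only [recSeqC, Int.cast_natCast, zpow_natCast]
      exact Finset.sum_coe_sort (expandingRoots P) fun β => (G β).eval (n : ℂ) * β ^ n
    rw [hgG, hexp, hzG, ← hsplit, Complex.add_re]
    ring
  rw [← Nat.map_cast_int_atTop, tendsto_map'_iff]
  simpa [Function.comp_def, hsub] using
    ((Complex.continuous_re.tendsto 0).comp hcontracting).neg

end Recurrence

section Coding

lemma aeval_shift_intCast (D : ℤ[X]) (u : ℤ → ℤ) :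
    aeval (shift ℂ) (D.map (algebraMap ℤ ℂ)) (fun n => (u n : ℂ)) =
      fun n => ((aeval (shift ℤ) D u n : ℤ) : ℂ) := by
  funext n
  rw [aeval_shift_apply, aeval_shift_apply,
    natDegree_map_eq_of_injective (RingHom.injective_int (algebraMap ℤ ℂ))]
  simp only [coeff_map, algebraMap_int_eq, eq_intCast, Int.cast_sum, Int.cast_mul]

/-- The `ℓ¹` norm of the coefficients of an integer polynomial. It bounds the letters of the words
that code sequences modulo `1`. -/
def coeffNorm (D : ℤ[X]) : ℤ := ∑ i ∈ Finset.range (D.natDegree + 1), |D.coeff i|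

lemma norm_aeval_shift_le_coeffNorm (D : ℤ[X]) {x : ℤ → ℂ} (hx : ∀ n, ‖x n‖ ≤ 1) (n : ℤ) :
    ‖aeval (shift ℂ) (D.map (algebraMap ℤ ℂ)) x n‖ ≤ coeffNorm D := by
  rw [aeval_shift_apply, natDegree_map_eq_of_injective (RingHom.injective_int _), coeffNorm,
    Int.cast_sum]
  refine (norm_sum_le _ _).trans (Finset.sum_le_sum fun i _ => ?_)
  rw [norm_mul, coeff_map, algebraMap_int_eq, eq_intCast, Complex.norm_intCast, Int.cast_abs]
  exact mul_le_of_le_one_right (abs_nonneg _) (hx _)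

variable {D : ℤ[X]} {B : ℤ}

/-- `y` sends every integer word `t` with letters in `[-B, B]` to a bounded complex sequence that
solves `∑ i, D.coeff i * y (n + i) = t n`, and does so continuously. The word `t` is the code of
this sequence. -/
structure IsBoundedSolution (D : ℤ[X]) (y : (ℤ → Set.Icc (-B) B) → ℤ → ℂ) : Prop where
  continuous : Continuous y
  exists_bound : ∃ M, ∀ t n, ‖y t n‖ ≤ M
  aeval_eq : ∀ t, aeval (shift ℂ) (D.map (algebraMap ℤ ℂ)) (y t) = fun n => ((t n : ℤ) : ℂ)

variable (B) in
lemma exists_isBoundedSolution (hD : ∀ z, (D.map (algebraMap ℤ ℂ)).IsRoot z → ‖z‖ ≠ 1) :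
    ∃ y : (ℤ → Set.Icc (-B) B) → ℤ → ℂ, IsBoundedSolution D y := by
  have hcont : Continuous fun (t : ℤ → Set.Icc (-B) B) (n : ℤ) => ((t n : ℤ) : ℂ) :=
    continuous_pi fun n => (continuous_of_discreteTopology
      (f := fun a : Set.Icc (-B) B => ((a : ℤ) : ℂ))).comp (continuous_apply n)
  obtain ⟨y, hy, hbound, heq⟩ := exists_continuous_bounded_solution hD hcont (B := B) fun t n => by
    rw [Complex.norm_intCast]
    exact_mod_cast abs_le.2 (t n).2
  exact ⟨y, hy, hbound, heq⟩

namespace IsBoundedSolution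

variable {y : (ℤ → Set.Icc (-B) B) → ℤ → ℂ}

lemma eq_of_aeval_eq (hy : IsBoundedSolution D y)
    (hD : ∀ z, (D.map (algebraMap ℤ ℂ)).IsRoot z → ‖z‖ ≠ 1) {t : ℤ → Set.Icc (-B) B} {f : ℤ → ℂ}
    {C : ℝ} (hf : ∀ n, ‖f n‖ ≤ C)
    (hft : aeval (shift ℂ) (D.map (algebraMap ℤ ℂ)) f = fun n => ((t n : ℤ) : ℂ)) : y t = f := by
  obtain ⟨M, hM⟩ := hy.exists_bound
  exact eq_of_aeval_shift_eq hD (fun n => (hM t n).trans (le_max_left M C))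
    (fun n => (hf n).trans (le_max_right M C)) ((hy.aeval_eq t).trans hft.symm)

lemma apply_translate (hy : IsBoundedSolution D y)
    (hD : ∀ z, (D.map (algebraMap ℤ ℂ)).IsRoot z → ‖z‖ ≠ 1) (t : ℤ → Set.Icc (-B) B) (n m : ℤ) :
    y (translate n t) m = y t (n + m) := by
  obtain ⟨M, hM⟩ := hy.exists_bound
  refine congrFun (hy.eq_of_aeval_eq hD (f := fun m => y t (n + m)) (fun m => hM t (n + m)) ?_) m
  funext m
  rw [aeval_shift_comp_add, hy.aeval_eq]
  rfl

lemma continuous_distInt_re (hy : IsBoundedSolution D y) :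
    Continuous fun t => distInt (y t 0).re :=
  continuous_distInt.comp (Complex.continuous_re.comp ((continuous_apply 0).comp hy.continuous))

end IsBoundedSolution

lemma exists_code_of_aeval_eq_zero (hD : ∀ z, (D.map (algebraMap ℤ ℂ)).IsRoot z → ‖z‖ ≠ 1)
    {y : (ℤ → Set.Icc (-coeffNorm D) (coeffNorm D)) → ℤ → ℂ} (hy : IsBoundedSolution D y)
    {x : ℤ → ℝ} (hx : aeval (shift ℂ) (D.map (algebraMap ℤ ℂ)) (fun n => (x n : ℂ)) = 0) :
    ∃ t, ∀ n, distInt (y (translate n t) 0).re = distInt (x n) := by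
  let e : ℤ → ℂ := fun n => (round (x n) : ℂ) - x n
  have he_le (n : ℤ) : ‖e n‖ ≤ 1 := by
    have h : e n = ((round (x n) - x n : ℝ) : ℂ) := by push_cast; rfl
    rw [h, Complex.norm_real, Real.norm_eq_abs, abs_sub_comm]
    exact (abs_sub_round _).trans (by norm_num)
  have he : aeval (shift ℂ) (D.map (algebraMap ℤ ℂ)) e =
      fun n => ((aeval (shift ℤ) D (fun n => round (x n)) n : ℤ) : ℂ) := by
    rw [← aeval_shift_intCast]
    refine Eq.trans ?_ ((map_sub _ _ _).trans ((congrArg _ hx).trans (sub_zero _)))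
    rfl
  have hletter (n : ℤ) : |aeval (shift ℤ) D (fun n => round (x n)) n| ≤ coeffNorm D := by
    have h := norm_aeval_shift_le_coeffNorm D he_le n
    rw [he, Complex.norm_intCast] at h
    exact_mod_cast h
  let t : ℤ → Set.Icc (-coeffNorm D) (coeffNorm D) := fun n => ⟨_, abs_le.1 (hletter n)⟩
  refine ⟨t, fun n => ?_⟩
  rw [hy.apply_translate hD, add_zero, hy.eq_of_aeval_eq hD he_le (t := t) he]
  simpa [e] using distInt_intCast_sub (round (x n)) (x n)

lemma exists_eventuallyEq_bddBelow_support (t : ℤ → Set.Icc (-B) B) :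
    ∃ s : ℤ → Set.Icc (-B) B,
      s =ᶠ[atTop] t ∧ BddBelow (Function.support fun n => (s n : ℤ)) := by
  have hB : 0 ≤ B := by linarith [(t 0).2.1, (t 0).2.2]
  refine ⟨fun n => if 0 ≤ n then t n else ⟨0, neg_nonpos.2 hB, hB⟩, ?_, 0, fun n hn => ?_⟩
  · filter_upwards [eventually_ge_atTop 0] with n hn
    exact if_pos hn
  · by_contra hneg
    exact hn (congrArg Subtype.val (if_neg hneg))

lemma Hyperbolic.norm_ne_one_of_isRoot {P : ℤ[X]} {k : ℕ} (hhyp : Hyperbolic P)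
    (hroots : D.map (algebraMap ℤ ℂ) = ∏ β ∈ (P.aroots ℂ).toFinset, (X - C β) ^ (k + 1)) {z : ℂ}
    (hz : (D.map (algebraMap ℤ ℂ)).IsRoot z) : ‖z‖ ≠ 1 := by
  rw [hroots, isRoot_prod] at hz
  obtain ⟨β, hβ, hzβ⟩ := hz
  obtain rfl : z = β := sub_eq_zero.1 (by simpa using hzβ)
  exact hhyp z (Multiset.mem_toFinset.1 hβ)

lemma exists_mem_Xi_limsup_eq {P : ℤ[X]} {k : ℕ} (hhyp : Hyperbolic P) (hmonic : D.Monic)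
    (hroots : D.map (algebraMap ℤ ℂ) = ∏ β ∈ (P.aroots ℂ).toFinset, (X - C β) ^ (k + 1))
    {y : (ℤ → Set.Icc (-B) B) → ℤ → ℂ} (hy : IsBoundedSolution D y) (t : ℤ → Set.Icc (-B) B) :
    ∃ g ∈ Xi P k, limsup (fun n : ℤ => distInt (y (translate n t) 0).re) atTop =
      limsup (fun n : ℤ => distInt (recSeq P g n)) atTop := by
  obtain ⟨s, hst, hs⟩ := exists_eventuallyEq_bddBelow_support t
  obtain ⟨u, hu⟩ := exists_aeval_shift_eq hmonic hs
  have hker : aeval (shift ℂ) (D.map (algebraMap ℤ ℂ)) ((fun n => (u n : ℂ)) - y s) = 0 := by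
    rw [map_sub, aeval_shift_intCast, hu, hy.aeval_eq, sub_self]
  obtain ⟨g, hg, hlim⟩ := exists_mem_Xi_tendsto_sub hhyp (hroots ▸ hker)
  have hφ := hy.continuous_distInt_re
  refine ⟨g, hg, (limsup_translate_congr hφ hst).symm.trans (Eq.symm ?_)⟩
  refine limsup_eq_of_tendsto_sub_zero (isBoundedUnder_le_translate hφ s)
    (isBoundedUnder_ge_translate hφ s)
    (squeeze_zero_norm (fun n => ?_) (tendsto_zero_iff_norm_tendsto_zero.1 hlim))
  have hsolution : distInt (y (translate n s) 0).re = distInt ((u n : ℂ) - y s n).re := by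
    rw [hy.apply_translate fun _ => hhyp.norm_ne_one_of_isRoot hroots, add_zero, Complex.sub_re,
      Complex.intCast_re, distInt_intCast_sub]
  rw [hsolution]
  exact abs_distInt_sub_distInt_le _ _

lemma exists_lagrangeSpectrum_eq_dynamicalSpectrum {P : ℤ[X]} (hmonic : P.Monic)
    (hhyp : Hyperbolic P) (k : ℕ) :
    ∃ (B : ℤ) (φ : (ℤ → Set.Icc (-B) B) → ℝ),
      Continuous φ ∧ lagrangeSpectrum P k = dynamicalSpectrum φ := by
  obtain ⟨Q, hQ, hQmap⟩ := exists_monic_map_eq_prod_aroots_toFinset (L := ℂ) ℚ hmonic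
  have hroots : (Q ^ (k + 1)).map (algebraMap ℤ ℂ) =
      ∏ β ∈ (P.aroots ℂ).toFinset, (X - C β) ^ (k + 1) := by
    rw [Polynomial.map_pow, hQmap, Finset.prod_pow]
  have hD : ∀ z, ((Q ^ (k + 1)).map (algebraMap ℤ ℂ)).IsRoot z → ‖z‖ ≠ 1 := fun _ =>
    hhyp.norm_ne_one_of_isRoot hroots
  obtain ⟨y, hy⟩ := exists_isBoundedSolution (coeffNorm (Q ^ (k + 1))) hD
  refine ⟨_, _, hy.continuous_distInt_re, Set.Subset.antisymm ?_ ?_⟩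
  · rintro _ ⟨g, hg, rfl⟩
    have hker : aeval (shift ℂ) ((Q ^ (k + 1)).map (algebraMap ℤ ℂ))
        (fun n => (recSeq P g n : ℂ)) = 0 := by
      simp only [ofReal_recSeq hg, hroots]
      exact aeval_shift_recSeqC hg.1
    obtain ⟨t, ht⟩ := exists_code_of_aeval_eq_zero hD hy hker
    exact ⟨t, by simp only [ht]⟩
  · rintro _ ⟨t, rfl⟩
    exact exists_mem_Xi_limsup_eq hhyp (hQ.pow _) hroots hy t

theorem isClosed_lagrangeSpectrum {P : ℤ[X]} (hmonic : P.Monic) (hhyp : Hyperbolic P) (k : ℕ) :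
    IsClosed (lagrangeSpectrum P k) := by
  obtain ⟨B, φ, hφ, heq⟩ := exists_lagrangeSpectrum_eq_dynamicalSpectrum hmonic hhyp k
  exact heq ▸ isClosed_dynamicalSpectrum hφ

end Coding

end

end MarkoffSpectrum

theorem theorem4p1_general (P : Polynomial ℤ) (hmonic : P.Monic)
    (hhyp : MarkoffSpectrum.Hyperbolic P) (k : ℕ) :
    MarkoffSpectrum.lagrangeSpectrum P k ⊆ Set.Icc 0 (1 / 2) ∧
      IsClosed (MarkoffSpectrum.lagrangeSpectrum P k) :=
  ⟨MarkoffSpectrum.lagrangeSpectrum_subset_Icc P k,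
    MarkoffSpectrum.isClosed_lagrangeSpectrum hmonic hhyp k⟩

/-- For an admissible, monic and hyperbolic integer polynomial, all the spectra are closed
subsets of `[0, 1/2]`. -/
theorem theorem4p1 (P : Polynomial ℤ) (hP : MarkoffSpectrum.Admissible P)
    (hmonic : P.Monic) (hhyp : MarkoffSpectrum.Hyperbolic P) (k : ℕ) :
    MarkoffSpectrum.lagrangeSpectrum P k ⊆ Set.Icc 0 (1 / 2) ∧
      IsClosed (MarkoffSpectrum.lagrangeSpectrum P k) := by
  exact theorem4p1_general P hmonic hhyp k
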